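/- Let $\varepsilon=\tfrac12\log\big((2/3)\,2^{2/3}\big)=0.02831\ldots$ (natural logarithm). Let $H$ be a finite abelian group, written additively, and let $m$ be a positive integer such that $H$ is generated by its elements of order at most $m$. A tricolored sum-free set in $H$ is a set $M\subseteq S\times T\times U$, for some subsets $S,T,U\subseteq H$, such that each of the three coordinate projections $M\to S$, $M\to T$, $M\to U$ is a bijection, $s+t+u=0$ for all $(s,t,u)\in M$, and $s+t+u\neq 0$ for all $(s,t,u)\in (S\times T\times U)\setminus M$. Then every tricolored sum-free set $M$ in $H$ satisfies $$|M|\le 3\cdot |H|^{\,1-\varepsilon/m}.$$ -/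

import Mathlib

/-- `M` is a 3-dimensional perfect matching on `S × T × U`: it is a subset of `S × T × U` whose
projection onto each of the three factors is a bijection. -/
structure IsPerfectMatching {H : Type*} (M : Set (H × H × H)) (S T U : Set H) : Prop where
  subset : M ⊆ S ×ˢ T ×ˢ U
  bijOn_fst : Set.BijOn (fun x => x.1) M S
  bijOn_snd : Set.BijOn (fun x => x.2.1) M T
  bijOn_thd : Set.BijOn (fun x => x.2.2) M U

/-- `M` is a tricolored sum-free set in the abelian group `H`: a 3-dimensional perfect matching on
some `S × T × U` with `S, T, U ⊆ H`, such that `s + t + u = 0` for every `(s, t, u) ∈ M` and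
`s + t + u ≠ 0` for every `(s, t, u) ∈ (S × T × U) \ M`. -/
def IsTricoloredSumFree {H : Type*} [AddCommGroup H] (M : Set (H × H × H)) : Prop :=
  ∃ S T U : Set H, IsPerfectMatching M S T U ∧
    (∀ s t u : H, (s, t, u) ∈ M → s + t + u = 0) ∧
    (∀ s t u : H, (s, t, u) ∈ (S ×ˢ T ×ˢ U) \ M → s + t + u ≠ 0)

/-- The absolute constant `ε = (1/2) log((2/3) 2^(2/3))` (natural logarithm). -/
noncomputable def sumFreeEpsilon : ℝ :=
  (1 / 2) * Real.log ((2 / 3) * (2 : ℝ) ^ (2 / 3 : ℝ))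

/-! This is the slice rank method over a well-chosen prime field. Write `H` as a product of cyclic
groups of prime power order; the generation hypothesis makes each order at most `m`. Let `N` be the
number of nontrivial `r`-power factors, for the prime `r` that maximizes it. Since ψ(m) ≤ 2m, log
|H| ≤ 2mN (`exists_prime_log_prod_le`). Over `ZMod r`, a tensor supported on x + y + z = 0 is built
factor by factor. On an `r`-power factor of order q it is a binomial coefficient, hence a
polynomial-like sum of total degree q - 1. Restricted to `M` the tensor is diagonal, so |M| is at
most its slice rank, hence at most three times the number of exponent tuples of normalized degree ≤
N/3. A Chernoff bound makes that count at most |H| exp(-2εN) ≤ |H|^(1 - ε/m). -/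

/-! ### Slice rank of diagonal tensors. -/

theorem Submodule.exists_finrank_le_card_support {F X : Type*} [Field F] [Fintype X]
    [DecidableEq F] (V : Submodule F (X → F)) :
    ∃ v ∈ V, Module.finrank F V ≤ (Finset.univ.filter fun x => v x ≠ 0).card := by
  classical
  let S : Set (Finset X) := {s | ∃ v ∈ V, (Finset.univ.filter fun x => v x ≠ 0) = s}
  -- Take `v` of maximal support. Were that support smaller than dim `V`, some nonzero `u` in `V`
  -- would vanish on it, and `v + u` would have larger support.
  obtain ⟨s, ⟨v, hv, rfl⟩, hmax⟩ := Set.exists_max_image S Finset.card (Set.toFinite S)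
    ⟨_, 0, V.zero_mem, rfl⟩
  refine ⟨v, hv, ?_⟩
  by_contra! hlt
  set s := Finset.univ.filter fun x => v x ≠ 0 with hs
  let r : V →ₗ[F] (s → F) := (LinearMap.funLeft F F (Subtype.val : s → X)).comp V.subtype
  have hr : LinearMap.ker r ≠ ⊥ := by
    apply LinearMap.ker_ne_bot_of_finrank_lt
    simpa using hlt
  obtain ⟨⟨u, hu⟩, hur, hu0⟩ := (Submodule.ne_bot_iff _).1 hr
  have hus : ∀ x, v x ≠ 0 → u x = 0 := fun x hx =>
    congrFun (LinearMap.mem_ker.1 hur) ⟨x, by simpa [hs] using hx⟩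
  obtain ⟨x, hx⟩ : ∃ x, u x ≠ 0 := by
    by_contra! h
    exact hu0 (Subtype.ext (funext h))
  have hlt' : s ⊂ Finset.univ.filter fun x => (v + u) x ≠ 0 := by
    refine Finset.ssubset_iff_of_subset (fun y hy => ?_) |>.2 ⟨x, ?_, ?_⟩
    · have hy' : v y ≠ 0 := by simpa [hs] using hy
      simpa [hus y hy'] using hy'
    · have : v x = 0 := by
        by_contra h
        exact hx (hus x h)
      simpa [this] using hx
    · have : v x = 0 := by
        by_contra h
        exact hx (hus x h)
      simp [hs, this]
  exact absurd (hmax _ ⟨v + u, V.add_mem hv hu, rfl⟩) (not_le.2 (Finset.card_lt_card hlt'))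

/-- A tensor supported exactly on the diagonal has slice rank equal to the size of the diagonal
(Tao's lemma). -/
theorem card_le_of_diagonal_eq_sum_slices {F X I J K : Type*} [Field F] [Fintype X]
    [Fintype I] [Fintype J] [Fintype K] (D : X → X → X → F)
    (hD : ∀ x y z, D x y z ≠ 0 ↔ x = y ∧ y = z)
    (f₁ : I → X → F) (g₁ : I → X → X → F) (f₂ : J → X → F) (g₂ : J → X → X → F)
    (f₃ : K → X → F) (g₃ : K → X → X → F)
    (h : ∀ x y z, D x y z = ∑ i, f₁ i x * g₁ i y z + ∑ j, f₂ j y * g₂ j x z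
      + ∑ k, f₃ k z * g₃ k x y) :
    Fintype.card X ≤ Fintype.card I + Fintype.card J + Fintype.card K := by
  classical
  -- Contracting with `v` kills the `f₁` slices and leaves a diagonal matrix of rank at least |X| -
  -- |I| that factors through J ⊕ K.
  obtain ⟨v, hv, hcard⟩ := (LinearMap.ker (Matrix.mulVecLin (Matrix.of f₁))
    ).exists_finrank_le_card_support
  have hker : Fintype.card X ≤ Fintype.card I
      + Module.finrank F (LinearMap.ker (Matrix.mulVecLin (Matrix.of f₁))) := by
    have h1 := LinearMap.finrank_range_add_finrank_ker (Matrix.mulVecLin (Matrix.of f₁))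
    have h2 := Submodule.finrank_le (LinearMap.range (Matrix.mulVecLin (Matrix.of f₁)))
    simp only [Module.finrank_fintype_fun_eq_card] at h1 h2
    omega
  have hv' : ∀ i, ∑ x, f₁ i x * v x = 0 := fun i => congrFun (LinearMap.mem_ker.1 hv) i
  let A : Matrix X J F := Matrix.of fun y j => f₂ j y
  let B : Matrix J X F := Matrix.of fun j z => ∑ x, v x * g₂ j x z
  let C : Matrix X K F := Matrix.of fun y k => ∑ x, v x * g₃ k x y
  let E : Matrix K X F := Matrix.of fun k z => f₃ k z
  have hdiag : Matrix.diagonal (fun y => v y * D y y y) = A * B + C * E := by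
    ext y z
    have h1 : ∑ x, v x * D x y z = (A * B + C * E) y z := by
      have h0 : ∑ x, v x * ∑ i, f₁ i x * g₁ i y z = 0 := by
        simp_rw [Finset.mul_sum]
        rw [Finset.sum_comm]
        refine Finset.sum_eq_zero fun i _ => ?_
        rw [← zero_mul (g₁ i y z), ← hv' i, Finset.sum_mul]
        exact Finset.sum_congr rfl fun x _ => by ring
      simp_rw [h, mul_add, Finset.sum_add_distrib]
      rw [h0, zero_add]
      simp only [Matrix.add_apply, Matrix.mul_apply, Matrix.of_apply, A, B, C, E, Finset.mul_sum, Finset.sum_mul]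
      congr 1
      · rw [Finset.sum_comm]
        exact Finset.sum_congr rfl fun x _ => Finset.sum_congr rfl fun j _ => by ring
      · rw [Finset.sum_comm]
        exact Finset.sum_congr rfl fun x _ => Finset.sum_congr rfl fun j _ => by ring
    rw [← h1]
    rcases eq_or_ne y z with rfl | hyz
    · rw [Matrix.diagonal_apply_eq, Finset.sum_eq_single y]
      · intro x _ hx
        have : D x y y = 0 := by
          by_contra hne
          exact hx ((hD _ _ _).1 hne).1
        rw [this, mul_zero]
      · simp
    · rw [Matrix.diagonal_apply_ne _ hyz]
      refine (Finset.sum_eq_zero fun x _ => ?_).symm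
      have : D x y z = 0 := by
        by_contra hne
        exact hyz ((hD _ _ _).1 hne).2
      rw [this, mul_zero]
  have hrank := congrArg Matrix.rank hdiag
  rw [Matrix.rank_diagonal] at hrank
  have hsupp : Fintype.card {y // v y * D y y y ≠ 0}
      = (Finset.univ.filter fun x => v x ≠ 0).card := by
    rw [Fintype.card_subtype]
    congr 1
    ext y
    simp [(hD y y y).2 ⟨rfl, rfl⟩]
  rw [← Matrix.fromCols_mul_fromRows] at hrank
  have h1 := (Matrix.rank_mul_le_left (Matrix.fromCols A C) (Matrix.fromRows B E)).trans
    (Matrix.rank_le_card_width _)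
  rw [Fintype.card_sum] at h1
  omega

/-- In each nonzero term one of the three weights is at most W/3; assigning the term to the first
such index yields slices. -/
theorem card_le_of_diagonal_eq_weighted_sum {F X A : Type*} [Field F] [Fintype X] [Fintype A]
    (D : X → X → X → F) (hD : ∀ x y z, D x y z ≠ 0 ↔ x = y ∧ y = z)
    (C : A → A → A → F) (φ χ ω : A → X → F)
    (h : ∀ x y z, D x y z = ∑ a, ∑ b, ∑ c, C a b c * (φ a x * χ b y * ω c z))
    (w : A → ℝ) (W : ℝ) (hC : ∀ a b c, C a b c ≠ 0 → w a + w b + w c = W) :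
    Fintype.card X ≤ 3 * (Finset.univ.filter fun a => w a ≤ W / 3).card := by
  classical
  set S := Finset.univ.filter fun a => w a ≤ W / 3 with hS
  have hmem : ∀ a, a ∈ S ↔ w a ≤ W / 3 := fun a => by simp [hS]
  have key := card_le_of_diagonal_eq_sum_slices (I := S) (J := S) (K := S) D hD
    (fun a x => φ a x) (fun a y z => ∑ b, ∑ c, C a b c * (χ b y * ω c z))
    (fun b y => χ b y)
    (fun b x z => ∑ a, ∑ c, if a ∈ S then 0 else C a b c * (φ a x * ω c z))
    (fun c z => ω c z)
    (fun c x y => ∑ a, ∑ b, if a ∈ S ∨ b ∈ S then 0 else C a b c * (φ a x * χ b y))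
    (fun x y z => by
      rw [h, Finset.sum_coe_sort S fun a => φ a x * ∑ b, ∑ c, C a b c * (χ b y * ω c z),
        Finset.sum_coe_sort S fun b =>
          χ b y * ∑ a, ∑ c, if a ∈ S then 0 else C a b c * (φ a x * ω c z),
        Finset.sum_coe_sort S fun c =>
          ω c z * ∑ a, ∑ b, if a ∈ S ∨ b ∈ S then 0 else C a b c * (φ a x * χ b y)]
      have e1 : ∀ G : A → F, ∑ a ∈ S, G a = ∑ a, if a ∈ S then G a else 0 := fun G => by
        rw [Finset.sum_ite_mem, Finset.univ_inter]
      rw [e1, e1, e1]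
      simp_rw [Finset.mul_sum]
      have e2 : (∑ b, if b ∈ S then ∑ a, ∑ c,
            χ b y * (if a ∈ S then 0 else C a b c * (φ a x * ω c z)) else 0)
          = ∑ a, ∑ b, ∑ c, if b ∈ S then
            χ b y * (if a ∈ S then 0 else C a b c * (φ a x * ω c z)) else 0 := by
        rw [Finset.sum_comm]
        refine Finset.sum_congr rfl fun b _ => ?_
        split_ifs <;> simp
      have e3 : (∑ c, if c ∈ S then ∑ a, ∑ b,
            ω c z * (if a ∈ S ∨ b ∈ S then 0 else C a b c * (φ a x * χ b y)) else 0)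
          = ∑ a, ∑ b, ∑ c, if c ∈ S then
            ω c z * (if a ∈ S ∨ b ∈ S then 0 else C a b c * (φ a x * χ b y)) else 0 := by
        symm
        rw [Finset.sum_congr (s₁ := Finset.univ) rfl fun a _ => Finset.sum_comm]
        rw [Finset.sum_comm]
        refine Finset.sum_congr rfl fun c _ => ?_
        split_ifs <;> simp
      have e4 : (∑ a, if a ∈ S then ∑ b, ∑ c, φ a x * (C a b c * (χ b y * ω c z)) else 0)
          = ∑ a, ∑ b, ∑ c, if a ∈ S then φ a x * (C a b c * (χ b y * ω c z)) else 0 := by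
        refine Finset.sum_congr rfl fun a _ => ?_
        split_ifs <;> simp
      rw [e2, e3, e4]
      simp_rw [← Finset.sum_add_distrib]
      refine Finset.sum_congr rfl fun a _ => Finset.sum_congr rfl fun b _ =>
        Finset.sum_congr rfl fun c _ => ?_
      by_cases ha : a ∈ S
      · simp [ha]; ring
      by_cases hb : b ∈ S
      · simp [ha, hb]; ring
      by_cases hc : c ∈ S
      · simp [ha, hb, hc]; ring
      have : C a b c = 0 := by
        by_contra hne
        have := hC a b c hne
        rw [hmem] at ha hb hc
        linarith
      simp [this])
  simp only [Fintype.card_coe] at key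
  omega

/-! ### Tensors supported on x + y + z = 0 in cyclic groups. -/

/-- Put q = p^e. If q ∣ w, adding q - 1 in base p causes no carry, so Kummer's theorem applies.
Conversely, w·C(w+q-1, q-1) = q·C(w+q-1, q) forces q ∣ w once C(w+q-1, q-1) is prime to p. -/
theorem Nat.Prime.dvd_choose_add_pow_sub_one_iff {p : ℕ} (hp : p.Prime) (e w : ℕ) :
    p ∣ (w + (p ^ e - 1)).choose (p ^ e - 1) ↔ ¬ p ^ e ∣ w := by
  have hq : 0 < p ^ e := pow_pos hp.pos e
  constructor
  · rintro hdvd ⟨k, rfl⟩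
    have hfac := Nat.factorization_choose' (n := p ^ e * k) (k := p ^ e - 1) hp
      (Nat.lt_succ_self (Nat.log p (p ^ e * k + (p ^ e - 1))))
    have : ((p ^ e * k + (p ^ e - 1)).choose (p ^ e - 1)).factorization p = 0 := by
      rw [hfac, Finset.card_eq_zero, Finset.filter_eq_empty_iff]
      intro i hi
      rw [not_le]
      rcases le_total i e with hie | hie
      · have hpi : p ^ i ∣ p ^ e := pow_dvd_pow p hie
        rw [Nat.mod_eq_zero_of_dvd (hpi.mul_right k), add_zero]
        exact Nat.mod_lt _ (pow_pos hp.pos i)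
      · obtain ⟨j, rfl⟩ := Nat.exists_eq_add_of_le hie
        have hpj : 0 < p ^ j := pow_pos hp.pos j
        rw [pow_add, Nat.mul_mod_mul_left, Nat.mod_eq_of_lt (a := p ^ e - 1)]
        · have := Nat.mod_lt k hpj
          have : p ^ e * (k % p ^ j + 1) ≤ p ^ e * p ^ j := Nat.mul_le_mul_left _ this
          rw [mul_add] at this
          omega
        · have := Nat.le_mul_of_pos_right (p ^ e) hpj
          omega
    have hpos : 0 < (p ^ e * k + (p ^ e - 1)).choose (p ^ e - 1) :=
      Nat.choose_pos (Nat.le_add_left _ _)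
    have := hp.factorization_pos_of_dvd hpos.ne' hdvd
    omega
  · intro hw
    by_contra hdvd
    have hcop : Nat.Coprime (p ^ e) ((w + (p ^ e - 1)).choose (p ^ e - 1)) :=
      Nat.Coprime.pow_left _ ((Nat.Prime.coprime_iff_not_dvd hp).2 hdvd)
    have hmul := Nat.choose_succ_right_eq (w + (p ^ e - 1)) (p ^ e - 1)
    rw [Nat.sub_add_cancel hq, Nat.add_sub_cancel] at hmul
    exact hw (hcop.dvd_of_dvd_mul_left ⟨_, by rw [← hmul, mul_comm]⟩)

theorem Nat.add_add_choose_eq (x y z k : ℕ) :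
    (x + y + z).choose k = ∑ a ∈ Finset.range (k + 1), ∑ b ∈ Finset.range (k + 1),
      ∑ c ∈ Finset.range (k + 1),
        if a + b + c = k then x.choose a * y.choose b * z.choose c else 0 := by
  rw [add_assoc, Nat.add_choose_eq, Finset.Nat.sum_antidiagonal_eq_sum_range_succ
    (fun i j => x.choose i * (y + z).choose j)]
  refine Finset.sum_congr rfl fun a ha => ?_
  rw [Nat.add_choose_eq, ← Finset.sum_product', ← Finset.sum_filter, Finset.mul_sum]
  refine Finset.sum_congr ?_ fun ij _ => by ring
  ext ⟨i, j⟩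
  simp only [Finset.mem_range] at ha
  simp only [Finset.HasAntidiagonal.mem_antidiagonal, Finset.mem_filter, Finset.mem_product, Finset.mem_range]
  omega

theorem exists_sum_zero_tensor_eq_of_prime_pow {p : ℕ} [Fact p.Prime] {q : ℕ} [NeZero q] {e : ℕ}
    (hq : q = p ^ e) :
    ∃ (C : Fin q → Fin q → Fin q → ZMod p) (φ χ ω : Fin q → ZMod q → ZMod p),
      (∀ x y z : ZMod q,
        ∑ a, ∑ b, ∑ c, C a b c * (φ a x * χ b y * ω c z) ≠ 0 ↔ x + y + z = 0) ∧
      ∀ a b c, C a b c ≠ 0 → (a : ℕ) + b + c = q - 1 := by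
  have hp : p.Prime := Fact.out
  refine ⟨fun a b c => if (a : ℕ) + b + c = q - 1 then 1 else 0,
    fun a x => (x.val.choose a : ℕ), fun b y => (y.val.choose b : ℕ),
    -- The shift by q - 1 is absorbed into the third variable, so the three-term Vandermonde
    -- identity applies.
    fun c z => ((z.val + (q - 1)).choose c : ℕ), fun x y z => ?_, fun a b c h => ?_⟩
  · have hsum : (∑ a : Fin q, ∑ b : Fin q, ∑ c : Fin q,
        (if (a : ℕ) + b + c = q - 1 then (1 : ZMod p) else 0) * (((x.val.choose a : ℕ) : ZMod p)
          * ((y.val.choose b : ℕ) : ZMod p) * (((z.val + (q - 1)).choose c : ℕ) : ZMod p)))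
        = ((x.val + y.val + z.val + (q - 1)).choose (q - 1) : ℕ) := by
      rw [add_assoc, Nat.add_add_choose_eq, Nat.sub_add_cancel (Nat.pos_of_neZero q)]
      simp only [Finset.sum_range, Nat.cast_sum]
      refine Finset.sum_congr rfl fun a _ => Finset.sum_congr rfl fun b _ =>
        Finset.sum_congr rfl fun c _ => ?_
      split_ifs <;> simp
    rw [hsum, Ne, ZMod.natCast_eq_zero_iff]
    have := hp.dvd_choose_add_pow_sub_one_iff e (x.val + y.val + z.val)
    rw [← hq] at this
    rw [this, not_not, ← ZMod.natCast_eq_zero_iff]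
    simp
  · by_contra hne
    simp [hne] at h

/-- Delta functions suffice at factors that save nothing; these will carry weight zero. -/
theorem exists_sum_zero_tensor_eq (F : Type*) [Field F] (q : ℕ) [NeZero q] :
    ∃ (C : Fin q → Fin q → Fin q → F) (φ χ ω : Fin q → ZMod q → F),
      ∀ x y z : ZMod q,
        ∑ a, ∑ b, ∑ c, C a b c * (φ a x * χ b y * ω c z) ≠ 0 ↔ x + y + z = 0 := by
  let δ : Fin q → ZMod q → F := fun a x => if a = ⟨x.val, x.val_lt⟩ then 1 else 0
  refine ⟨fun a b c => if ((a : ℕ) + (b : ℕ) + (c : ℕ) : ZMod q) = 0 then 1 else 0, δ, δ, δ,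
    fun x y z => ?_⟩
  simp only [δ, mul_ite, mul_one, mul_zero]
  simp

/-! ### Exponent counting and the product bound. -/

/-- Chernoff bound: the indicator is dominated by (1/2)^(excess weight), which factors over `i`. -/
theorem card_filter_sum_le_prod {ι : Type*} [Fintype ι] [DecidableEq ι] {A : ι → Type*}
    [∀ i, Fintype (A i)] (w : ∀ i, A i → ℝ) (W B : ι → ℝ)
    (hB : ∀ i, ∑ a, (1 / 2 : ℝ) ^ (w i a - W i) ≤ B i) :
    ((Finset.univ.filter fun a : ∀ i, A i => ∑ i, w i (a i) ≤ ∑ i, W i).card : ℝ)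
      ≤ ∏ i, B i := by
  calc ((Finset.univ.filter fun a : ∀ i, A i => ∑ i, w i (a i) ≤ ∑ i, W i).card : ℝ)
      = ∑ a : ∀ i, A i, if ∑ i, w i (a i) ≤ ∑ i, W i then (1 : ℝ) else 0 := by
        rw [Finset.sum_boole]
    _ ≤ ∑ a : ∀ i, A i, ∏ i, (1 / 2 : ℝ) ^ (w i (a i) - W i) := by
        refine Finset.sum_le_sum fun a _ => ?_
        split_ifs with h
        · rw [← Real.rpow_sum_of_pos (by norm_num), Finset.sum_sub_distrib]
          exact Real.one_le_rpow_of_pos_of_le_one_of_nonpos (by norm_num) (by norm_num)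
            (by linarith)
        · exact Finset.prod_nonneg fun i _ => by positivity
    _ = ∏ i, ∑ a, (1 / 2 : ℝ) ^ (w i a - W i) :=
        (Fintype.prod_sum fun i a => (1 / 2 : ℝ) ^ (w i a - W i)).symm
    _ ≤ ∏ i, B i := Finset.prod_le_prod (fun i _ => by positivity) fun i _ => hB i

theorem IsPerfectMatching.eq_of_mem {H : Type*} {M : Set (H × H × H)} {S T U : Set H}
    (hM : IsPerfectMatching M S T U) {x y z : H × H × H} (hx : x ∈ M) (hy : y ∈ M) (hz : z ∈ M)
    (h : (x.1, y.2.1, z.2.2) ∈ M) : x = y ∧ y = z := by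
  have h1 := hM.bijOn_fst.injOn h hx rfl
  have h2 := hM.bijOn_snd.injOn h hy rfl
  have h3 := hM.bijOn_thd.injOn h hz rfl
  exact ⟨h1.symm.trans h2, h2.symm.trans h3⟩

theorem IsTricoloredSumFree.add_add_eq_zero_iff {H : Type*} [AddCommGroup H]
    {M : Set (H × H × H)} (hM : IsTricoloredSumFree M) (x y z : M) :
    x.1.1 + y.1.2.1 + z.1.2.2 = 0 ↔ x = y ∧ y = z := by
  obtain ⟨S, T, U, hmatch, hmem, hnot⟩ := hM
  constructor
  · intro h
    have hin : (x.1.1, y.1.2.1, z.1.2.2) ∈ M := by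
      by_contra hout
      exact hnot x.1.1 y.1.2.1 z.1.2.2 ⟨⟨(hmatch.subset x.2).1, (hmatch.subset y.2).2.1,
        (hmatch.subset z.2).2.2⟩, hout⟩ h
    obtain ⟨h1, h2⟩ := hmatch.eq_of_mem x.2 y.2 z.2 hin
    exact ⟨Subtype.ext h1, Subtype.ext h2⟩
  · rintro ⟨rfl, rfl⟩
    exact hmem _ _ _ x.2

theorem IsTricoloredSumFree.ncard_le_prod {F : Type*} [Field F] {ι : Type*} [Fintype ι]
    [DecidableEq ι] {H : Type*} [AddCommGroup H] [Finite H] {M : Set (H × H × H)}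
    (hM : IsTricoloredSumFree M) {G : ι → Type*} [∀ i, AddCommGroup (G i)] (f : H ≃+ ∀ i, G i)
    {A : ι → Type*} [∀ i, Fintype (A i)] (C : ∀ i, A i → A i → A i → F)
    (φ χ ω : ∀ i, A i → G i → F)
    (hC : ∀ i x y z,
      ∑ a, ∑ b, ∑ c, C i a b c * (φ i a x * χ i b y * ω i c z) ≠ 0 ↔ x + y + z = 0)
    (w : ∀ i, A i → ℝ) (W B : ι → ℝ)
    (hw : ∀ i a b c, C i a b c ≠ 0 → w i a + w i b + w i c = W i)
    (hB : ∀ i, ∑ a, (1 / 2 : ℝ) ^ (w i a - W i / 3) ≤ B i) :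
    (M.ncard : ℝ) ≤ 3 * ∏ i, B i := by
  classical
  have := Fintype.ofFinite M
  have key := card_le_of_diagonal_eq_weighted_sum (X := M) (A := ∀ i, A i)
    (fun x y z => ∏ i, ∑ a, ∑ b, ∑ c,
      C i a b c * (φ i a (f x.1.1 i) * χ i b (f y.1.2.1 i) * ω i c (f z.1.2.2 i)))
    (fun x y z => by
      rw [Finset.prod_ne_zero_iff, ← hM.add_add_eq_zero_iff,
        ← f.map_eq_zero_iff (x := x.1.1 + y.1.2.1 + z.1.2.2), funext_iff]
      simp [hC])
    (fun a b c => ∏ i, C i (a i) (b i) (c i))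
    (fun a x => ∏ i, φ i (a i) (f x.1.1 i)) (fun b y => ∏ i, χ i (b i) (f y.1.2.1 i))
    (fun c z => ∏ i, ω i (c i) (f z.1.2.2 i))
    (fun x y z => by simp_rw [Fintype.prod_sum, Finset.prod_mul_distrib])
    (fun a => ∑ i, w i (a i)) (∑ i, W i)
    (fun a b c h => by
      rw [← Finset.sum_add_distrib, ← Finset.sum_add_distrib]
      exact Finset.sum_congr rfl fun i _ =>
        hw i _ _ _ (Finset.prod_ne_zero_iff.1 h i (Finset.mem_univ i)))
  have hcard := card_filter_sum_le_prod w (fun i => W i / 3) B hB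
  rw [← Finset.sum_div] at hcard
  have hn : M.ncard = Fintype.card M := by rw [← Nat.card_coe_set_eq, Nat.card_eq_fintype_card]
  rw [hn]
  refine le_trans (by exact_mod_cast key) (mul_le_mul_of_nonneg_left hcard (by norm_num))

/-! ### Orders of the cyclic factors. -/

theorem ZMod.prime_pow_le_of_closure_addOrderOf_le {H : Type*} [AddCommGroup H] [Finite H]
    {m p e : ℕ} (hp : p.Prime) (hm : 0 < m)
    (hgen : AddSubgroup.closure {h : H | addOrderOf h ≤ m} = ⊤) (π : H →+ ZMod (p ^ e))
    (hπ : Function.Surjective π) : p ^ e ≤ m := by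
  by_contra! hlt
  obtain _ | e := e
  · simp at hlt
    omega
  -- The exponent is now e + 1: generators map to elements of order at most m < p^(e+1), hence
  -- killed by p^e, whereas 1 is not.
  have hle : AddSubgroup.closure {h : H | addOrderOf h ≤ m} ≤ ((p ^ e) • π).ker := by
    rw [AddSubgroup.closure_le]
    intro h hh
    have hk : addOrderOf (π h) ∣ addOrderOf h := addOrderOf_map_dvd π h
    have hk' : addOrderOf (π h) ∣ p ^ (e + 1) := by
      have := addOrderOf_dvd_natCard (π h)
      rwa [Nat.card_zmod] at this
    have hkm : addOrderOf (π h) ≤ m := (Nat.le_of_dvd (addOrderOf_pos h) hk).trans hh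
    obtain ⟨j, hj, hje⟩ := (Nat.dvd_prime_pow hp).1 hk'
    have hje' : j ≤ e := by
      by_contra hc
      rw [hje, show j = e + 1 by omega] at hkm
      omega
    have : addOrderOf (π h) ∣ p ^ e := hje ▸ pow_dvd_pow p hje'
    simpa [AddMonoidHom.mem_ker] using addOrderOf_dvd_iff_nsmul_eq_zero.1 this
  rw [hgen] at hle
  obtain ⟨h, hh⟩ := hπ 1
  have h0 : (p ^ e) • π h = 0 := hle (AddSubgroup.mem_top h)
  rw [hh, nsmul_one, ZMod.natCast_eq_zero_iff, Nat.pow_dvd_pow_iff_le_right hp.one_lt] at h0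
  omega

/-! ### The constant ε and the saving per factor. -/

theorem sumFreeEpsilon_eq : sumFreeEpsilon = (5 * Real.log 2 - 3 * Real.log 3) / 6 := by
  rw [sumFreeEpsilon, Real.log_mul (by norm_num) (by positivity), Real.log_rpow (by norm_num),
    Real.log_div (by norm_num) (by norm_num)]
  ring

theorem sumFreeEpsilon_bounds : 0.02831 < sumFreeEpsilon ∧ sumFreeEpsilon < 0.02832 := by
  rw [sumFreeEpsilon_eq]
  constructor <;> linarith [Real.log_two_gt_d9, Real.log_two_lt_d9, Real.log_three_gt_d9,
    Real.log_three_lt_d9]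

theorem exp_neg_two_mul_sumFreeEpsilon :
    Real.exp (-2 * sumFreeEpsilon) = 3 / 4 * (1 / 2 : ℝ) ^ (-(1 / 3) : ℝ) := by
  rw [sumFreeEpsilon_eq, ← Real.exp_log (x := 3 / 4 * (1 / 2 : ℝ) ^ (-(1 / 3) : ℝ))
    (by positivity), Real.log_mul (by norm_num) (by positivity), Real.log_rpow (by norm_num),
    Real.log_div (by norm_num) (by norm_num), one_div (2 : ℝ), Real.log_inv,
    show (4 : ℝ) = 2 ^ 2 by norm_num, Real.log_pow]
  congr 1
  push_cast
  ring

/-- By convexity (1/2)^t ≤ 1 - t/2 on [0, 1]; the average of t = a/(q-1) is 1/2, which produces the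
factor 3/4. -/
theorem sum_half_rpow_le {q : ℕ} (hq : 2 ≤ q) :
    ∑ a : Fin q, (1 / 2 : ℝ) ^ ((a : ℝ) / (q - 1) - 1 / 3)
      ≤ q * Real.exp (-2 * sumFreeEpsilon) := by
  have hq' : (0 : ℝ) < q - 1 := by
    have : (2 : ℝ) ≤ q := by exact_mod_cast hq
    linarith
  have hsum : ∑ a : Fin q, (a : ℝ) = q * (q - 1) / 2 := by
    rw [← Finset.sum_range (fun a : ℕ => (a : ℝ)), ← Nat.cast_sum, eq_div_iff two_ne_zero]
    have := Finset.sum_range_id_mul_two q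
    have hcast : ((q - 1 : ℕ) : ℝ) = q - 1 := by
      rw [Nat.cast_sub (by omega), Nat.cast_one]
    rw [← hcast]
    exact_mod_cast this
  calc ∑ a : Fin q, (1 / 2 : ℝ) ^ ((a : ℝ) / (q - 1) - 1 / 3)
      ≤ ∑ a : Fin q, (1 - (a : ℝ) * (1 / (2 * (q - 1)))) * (1 / 2 : ℝ) ^ (-(1 / 3) : ℝ) := by
        refine Finset.sum_le_sum fun a _ => ?_
        rw [sub_eq_add_neg, Real.rpow_add (by norm_num)]
        refine mul_le_mul_of_nonneg_right ?_ (by positivity)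
        have ha : (a : ℝ) ≤ q - 1 := by
          have : (a : ℕ) + 1 ≤ q := a.2
          have : ((a : ℕ) : ℝ) + 1 ≤ q := by exact_mod_cast this
          linarith
        have := rpow_one_add_le_one_add_mul_self (s := -(1 / 2)) (by norm_num)
          (p := (a : ℝ) / (q - 1)) (by positivity) ((div_le_one hq').2 ha)
        rw [show (1 : ℝ) + -(1 / 2) = 1 / 2 by norm_num] at this
        refine this.trans_eq ?_
        field_simp
        ring
    _ = q * Real.exp (-2 * sumFreeEpsilon) := by
        rw [← Finset.sum_mul, Finset.sum_sub_distrib, ← Finset.sum_mul, hsum,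
          exp_neg_two_mul_sumFreeEpsilon]
        simp only [Finset.sum_const, Finset.card_univ, Fintype.card_fin, nsmul_eq_mul, mul_one]
        field_simp
        ring

/-! ### A Chebyshev bound. -/

/-- The sum is ψ(n). It exceeds θ(n) ≤ n log 4 only through primes p ≤ √n, each by at most log n -
log 2. -/
theorem sum_primesLE_log_mul_log_le (n : ℕ) :
    ∑ p ∈ n.primesLE, (Nat.log p n : ℝ) * Real.log p ≤ 2 * n := by
  rcases lt_or_ge n 2 with hn | hn
  · interval_cases n <;> simp
  have hn0 : n ≠ 0 := by omega
  have hn' : (2 : ℝ) ≤ n := by exact_mod_cast hn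
  set D := Real.log n - Real.log 2 with hD
  have hD0 : 0 ≤ D := sub_nonneg.2 (Real.log_le_log (by norm_num) hn')
  set r := √(n : ℝ) with hr
  have hr0 : 0 < r := Real.sqrt_pos.2 (by linarith)
  have hr1 : 1 ≤ r := Real.one_le_sqrt.2 (by linarith)
  have hrr : r ^ 2 = n := Real.sq_sqrt (by linarith)
  have hterm : ∀ p ∈ n.primesLE, (Nat.log p n : ℝ) * Real.log p
      ≤ Real.log p + if p ≤ Nat.sqrt n then D else 0 := by
    intro p hp
    obtain ⟨hpn, hp⟩ := Nat.mem_primesLE.1 hp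
    have hp2 : (2 : ℝ) ≤ p := by exact_mod_cast hp.two_le
    have hlog2 : Real.log 2 ≤ Real.log p := Real.log_le_log (by norm_num) hp2
    split_ifs with h
    · have : (Nat.log p n : ℝ) * Real.log p ≤ Real.log n := by
        rw [← Real.log_pow]
        exact Real.log_le_log (by positivity) (by exact_mod_cast Nat.pow_log_le_self p hn0)
      linarith
    · have h1 : Nat.log p n < 2 := Nat.log_lt_of_lt_pow hn0 (by
        rw [sq]
        exact Nat.sqrt_lt.1 (not_le.1 h))
      have : (Nat.log p n : ℝ) ≤ 1 := by exact_mod_cast Nat.lt_succ_iff.1 h1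
      nlinarith [Real.log_nonneg (by linarith : (1 : ℝ) ≤ p)]
  have hcard : ((n.primesLE.filter (· ≤ Nat.sqrt n)).card : ℝ) ≤ r - 1 := by
    have hsub : n.primesLE.filter (· ≤ Nat.sqrt n) ⊆ Finset.Icc 2 (Nat.sqrt n) := by
      intro p hp
      rw [Finset.mem_filter, Nat.mem_primesLE] at hp
      exact Finset.mem_Icc.2 ⟨hp.1.2.two_le, hp.2⟩
    have h1 := Finset.card_le_card hsub
    rw [Nat.card_Icc] at h1
    have hs : 1 ≤ Nat.sqrt n := Nat.sqrt_pos.2 (by omega)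
    have h2 : (n.primesLE.filter (· ≤ Nat.sqrt n)).card + 1 ≤ Nat.sqrt n := by omega
    have h3 : ((n.primesLE.filter (· ≤ Nat.sqrt n)).card : ℝ) + 1 ≤ Nat.sqrt n := by
      exact_mod_cast h2
    linarith [Real.nat_sqrt_le_real_sqrt (a := n)]
  have htheta : ∑ p ∈ n.primesLE, Real.log p ≤ Real.log 4 * n := by
    rw [← Chebyshev.theta_eq_sum_primesLE_log]
    exact Chebyshev.theta_le_log4_mul_x (Nat.cast_nonneg n)
  have hlog4 : Real.log 4 = 2 * Real.log 2 := by
    rw [show (4 : ℝ) = 2 ^ 2 by norm_num, Real.log_pow]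
    norm_num
  -- Tangent line of log at r = 4; its slope keeps the leading coefficient log 4 + 1/2 below 2.
  have hDle : D ≤ r / 2 - 2 + 3 * Real.log 2 := by
    have h1 : Real.log n = 2 * Real.log r := by
      rw [← hrr, Real.log_pow]
      norm_num
    have h2 := Real.log_le_sub_one_of_pos (show 0 < r / 4 by positivity)
    rw [Real.log_div hr0.ne' (by norm_num), hlog4] at h2
    linarith
  calc ∑ p ∈ n.primesLE, (Nat.log p n : ℝ) * Real.log p
      ≤ ∑ p ∈ n.primesLE, (Real.log p + if p ≤ Nat.sqrt n then D else 0) :=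
        Finset.sum_le_sum hterm
    _ = ∑ p ∈ n.primesLE, Real.log p + (n.primesLE.filter (· ≤ Nat.sqrt n)).card * D := by
        rw [Finset.sum_add_distrib, ← Finset.sum_filter, Finset.sum_const, nsmul_eq_mul]
    _ ≤ Real.log 4 * n + (r - 1) * (r / 2 - 2 + 3 * Real.log 2) := by
        refine add_le_add htheta (mul_le_mul hcard hDle hD0 (by linarith))
    _ ≤ 2 * n := by
        rw [hlog4, ← hrr]
        nlinarith [Real.log_two_gt_d9, Real.log_two_lt_d9,
          mul_nonneg (sub_nonneg.2 Real.log_two_lt_d9.le) (sq_nonneg r),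
          mul_nonneg (sub_nonneg.2 Real.log_two_lt_d9.le) (sub_nonneg.2 hr1)]

/-! ### Choice of the prime and assembly. -/

theorem IsTricoloredSumFree.ncard_le_exp_card_filter {ι : Type*} [Fintype ι] {H : Type*}
    [AddCommGroup H] [Finite H] {M : Set (H × H × H)} (hM : IsTricoloredSumFree M)
    {p e : ι → ℕ} (hp : ∀ i, (p i).Prime) (f : H ≃+ ∀ i, ZMod (p i ^ e i)) {r : ℕ}
    (hr : r.Prime) :
    (M.ncard : ℝ) ≤ 3 * (Nat.card H * Real.exp
      (-2 * sumFreeEpsilon * (Finset.univ.filter fun i => p i = r ∧ e i ≠ 0).card)) := by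
  classical
  have : Fact r.Prime := ⟨hr⟩
  have (i : ι) : NeZero (p i ^ e i) := ⟨pow_ne_zero _ (hp i).ne_zero⟩
  have htensor : ∀ i, ∃ (C : Fin (p i ^ e i) → Fin (p i ^ e i) → Fin (p i ^ e i) → ZMod r)
      (φ χ ω : Fin (p i ^ e i) → ZMod (p i ^ e i) → ZMod r),
      (∀ x y z : ZMod (p i ^ e i),
        ∑ a, ∑ b, ∑ c, C a b c * (φ a x * χ b y * ω c z) ≠ 0 ↔ x + y + z = 0) ∧
      ∀ a b c, C a b c ≠ 0 → (p i = r ∧ e i ≠ 0) → (a : ℕ) + b + c = p i ^ e i - 1 := by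
    intro i
    by_cases hi : p i = r ∧ e i ≠ 0
    · obtain ⟨C, φ, χ, ω, h1, h2⟩ :=
        exists_sum_zero_tensor_eq_of_prime_pow (p := r) (q := p i ^ e i) (e := e i) (by rw [hi.1])
      exact ⟨C, φ, χ, ω, h1, fun a b c h _ => h2 a b c h⟩
    · obtain ⟨C, φ, χ, ω, h1⟩ := exists_sum_zero_tensor_eq (ZMod r) (p i ^ e i)
      exact ⟨C, φ, χ, ω, h1, fun a b c _ h => absurd h hi⟩
  choose C φ χ ω hC hdeg using htensor
  have hq : ∀ i, (p i = r ∧ e i ≠ 0) → 2 ≤ p i ^ e i := fun i hi =>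
    Nat.one_lt_pow hi.2 (hp i).one_lt
  have key := hM.ncard_le_prod f C φ χ ω hC
    -- Degrees are divided by q - 1 so that every `r`-power factor has total weight 1; e i ≠ 0 keeps
    -- the divisor nonzero.
    (fun i a => if p i = r ∧ e i ≠ 0 then (a : ℝ) / (((p i ^ e i : ℕ) : ℝ) - 1) else 0)
    (fun i => if p i = r ∧ e i ≠ 0 then 1 else 0)
    (fun i => ((p i ^ e i : ℕ) : ℝ) *
      if p i = r ∧ e i ≠ 0 then Real.exp (-2 * sumFreeEpsilon) else 1)
    (fun i a b c h => by
      split_ifs with hi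
      · have h2 : (2 : ℝ) ≤ (p i ^ e i : ℕ) := by exact_mod_cast hq i hi
        have h3 : (a : ℝ) + (b : ℝ) + (c : ℝ) = ((p i ^ e i : ℕ) : ℝ) - 1 := by
          rw [← Nat.cast_pred (Nat.pos_of_neZero _), ← hdeg i a b c h hi]
          push_cast
          ring
        rw [← add_div, ← add_div, h3, div_self (by linarith)]
      · simp)
    (fun i => by
      split_ifs with hi
      · exact sum_half_rpow_le (hq i hi)
      · simp)
  rw [Finset.prod_mul_distrib, Finset.prod_ite, Finset.prod_const, Finset.prod_const_one,
    mul_one, ← Real.exp_nat_mul] at key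
  have hcard : Nat.card H = ∏ i, p i ^ e i := by
    rw [Nat.card_congr f.toEquiv, Nat.card_pi]
    simp
  rw [hcard, Nat.cast_prod, mul_comm (-2 * sumFreeEpsilon)]
  exact key

theorem exists_prime_log_prod_le {ι : Type*} [Fintype ι] {p e : ι → ℕ}
    (hp : ∀ i, (p i).Prime) {m : ℕ} (hm : ∀ i, p i ^ e i ≤ m) :
    ∃ r : ℕ, r.Prime ∧ Real.log (∏ i, p i ^ e i : ℕ)
      ≤ 2 * m * (Finset.univ.filter fun i => p i = r ∧ e i ≠ 0).card := by
  classical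
  let N : ℕ → ℕ := fun r => (Finset.univ.filter fun i => p i = r ∧ e i ≠ 0).card
  obtain ⟨r, hr, hmax⟩ : ∃ r, r.Prime ∧ ∀ s ∈ m.primesLE, N s ≤ N r := by
    rcases m.primesLE.eq_empty_or_nonempty with h | h
    -- Without primes up to `m` all factors are trivial, and any prime serves.
    · exact ⟨2, Nat.prime_two, by simp [h]⟩
    · obtain ⟨r, hr, hmax⟩ := Finset.exists_max_image _ N h
      exact ⟨r, (Nat.mem_primesLE.1 hr).2, hmax⟩
  refine ⟨r, hr, ?_⟩
  have hlog : ∀ s ∈ m.primesLE, 0 ≤ (Nat.log s m : ℝ) * Real.log s := fun s _ => by positivity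
  calc Real.log (∏ i, p i ^ e i : ℕ)
      = ∑ i, (e i : ℝ) * Real.log (p i) := by
        rw [Nat.cast_prod, Real.log_prod fun i _ => by
          exact_mod_cast pow_ne_zero _ (hp i).ne_zero]
        simp
    _ = ∑ i with e i ≠ 0, (e i : ℝ) * Real.log (p i) := by
        refine (Finset.sum_filter_of_ne (p := fun i => e i ≠ 0) fun i _ h h0 => h ?_).symm
        simp [h0]
    _ ≤ ∑ i with e i ≠ 0, (Nat.log (p i) m : ℝ) * Real.log (p i) := by
        refine Finset.sum_le_sum fun i _ => ?_
        refine mul_le_mul_of_nonneg_right ?_ (Real.log_natCast_nonneg _)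
        exact_mod_cast Nat.le_log_of_pow_le (hp i).one_lt (hm i)
    _ = ∑ s ∈ m.primesLE, ∑ i with e i ≠ 0 ∧ p i = s, (Nat.log (p i) m : ℝ) * Real.log (p i) := by
        rw [← Finset.sum_fiberwise_of_maps_to (t := m.primesLE) (g := p)]
        · simp_rw [Finset.filter_filter]
        · intro i hi
          rw [Finset.mem_filter] at hi
          exact Nat.mem_primesLE.2 ⟨(Nat.le_self_pow hi.2 _).trans (hm i), hp i⟩
    _ = ∑ s ∈ m.primesLE, N s * ((Nat.log s m : ℝ) * Real.log s) := by
        refine Finset.sum_congr rfl fun s _ => ?_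
        simp_rw [N, and_comm (a := p _ = s)]
        rw [← nsmul_eq_mul, ← Finset.sum_const]
        refine Finset.sum_congr rfl fun i hi => ?_
        rw [(Finset.mem_filter.1 hi).2.2]
    _ ≤ ∑ s ∈ m.primesLE, N r * ((Nat.log s m : ℝ) * Real.log s) :=
        Finset.sum_le_sum fun s hs =>
          mul_le_mul_of_nonneg_right (by exact_mod_cast hmax s hs) (hlog s hs)
    _ ≤ 2 * m * N r := by
        rw [← Finset.mul_sum, mul_comm]
        exact mul_le_mul_of_nonneg_right (sum_primesLE_log_mul_log_le m) (Nat.cast_nonneg _)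

theorem theoremA :
    (0.02831 < sumFreeEpsilon ∧ sumFreeEpsilon < 0.02832) ∧
    ∀ (H : Type*) [AddCommGroup H] [Finite H] (m : ℕ), 0 < m →
      AddSubgroup.closure {h : H | addOrderOf h ≤ m} = ⊤ →
      ∀ M : Set (H × H × H), IsTricoloredSumFree M →
        (M.ncard : ℝ) ≤ 3 * (Nat.card H : ℝ) ^ (1 - sumFreeEpsilon / (m : ℝ)) := by
  classical
  refine ⟨sumFreeEpsilon_bounds, fun H _ _ m hm hgen M hM => ?_⟩
  obtain ⟨ι, _, p, hp, e, ⟨g⟩⟩ := AddCommGroup.equiv_directSum_zmod_of_finite H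
  let f : H ≃+ ∀ i, ZMod (p i ^ e i) := g.trans (DirectSum.addEquivProd _)
  have hpm : ∀ i, p i ^ e i ≤ m := fun i =>
    ZMod.prime_pow_le_of_closure_addOrderOf_le (hp i) hm hgen
      ((Pi.evalAddMonoidHom (fun i => ZMod (p i ^ e i)) i).comp f.toAddMonoidHom)
      ((Function.surjective_eval i).comp f.surjective)
  obtain ⟨r, hr, hlog⟩ := exists_prime_log_prod_le hp hpm
  refine (hM.ncard_le_exp_card_filter hp f hr).trans ?_
  have hcard : Nat.card H = ∏ i, p i ^ e i := by
    rw [Nat.card_congr f.toEquiv, Nat.card_pi]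
    simp
  rw [← hcard] at hlog
  have hpos : (0 : ℝ) < Nat.card H := by exact_mod_cast Nat.card_pos
  have hm' : (0 : ℝ) < m := by exact_mod_cast hm
  have hε : 0 < sumFreeEpsilon := by linarith [sumFreeEpsilon_bounds.1]
  rw [Real.rpow_sub hpos, Real.rpow_one, div_eq_mul_inv _ ((_ : ℝ) ^ _), ← Real.rpow_neg hpos.le,
    Real.rpow_def_of_pos hpos]
  refine mul_le_mul_of_nonneg_left (mul_le_mul_of_nonneg_left (Real.exp_le_exp.2 ?_) hpos.le)
    (by norm_num)
  rw [mul_neg, mul_div_assoc', le_neg, neg_mul, neg_mul, neg_neg, div_le_iff₀ hm']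
  nlinarith [mul_le_mul_of_nonneg_left hlog hε.le]
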